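/- Let \(\mathbb{H}^2\) be the oriented hyperbolic plane and let \(\mathrm{Isom}^+(\mathbb{H}^2)\) be its group of orientation preserving isometries, with the topology of pointwise convergence. Fix a point \(p_0\in\mathbb{H}^2\) and a unit tangent vector \(v\in T_{p_0}\mathbb{H}^2\). Let \(R\) be the clockwise rotation by a right angle fixing \(p_0\), for \(r>0\) let \(A_r\) be the translation of distance \(r\) along the geodesic with initial condition \(v\), in the direction of \(v\), and let \(G_r\) be the subgroup of \(\mathrm{Isom}^+(\mathbb{H}^2)\) generated by \(R\) and \(A_r\). For \(t>4\) put \[ r_t=\operatorname{arcosh}\left(1+2\cos\left(\frac{2\pi}{t}\right)\right). \] If \(t=p/q>4\), where \(p\) and \(q\) are coprime positive integers and \(q>1\), then \(G_{r_t}\) is dense in \(\mathrm{Isom}^+(\mathbb{H}^2)\). -/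

import Mathlib

open scoped UpperHalfPlane MatrixGroups

noncomputable section

namespace HypPlane

open UpperHalfPlane

/-- A self-map of the upper half-plane read in the global coordinate `ℍ ⊆ ℂ`
(only its germs at points of the half-plane matter). -/
def inCoord (f : ℍ → ℍ) : ℂ → ℂ := fun w => (f (ofComplex w) : ℂ)

/-- A map `ℍ → ℍ` preserves the orientation if its real differential has positive determinant
at every point. (Since `fderiv` is `0` where the map is not differentiable, this includes
differentiability.) -/
def OrientationPreserving (f : ℍ → ℍ) : Prop :=
  ∀ z : ℍ, 0 < (fderiv ℝ (inCoord f) (z : ℂ)).det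

theorem det_zero_clm : (0 : ℂ →L[ℝ] ℂ).det = 0 := by
  simp [ContinuousLinearMap.det]

theorem OrientationPreserving.differentiableAt {f : ℍ → ℍ} (hf : OrientationPreserving f)
    (z : ℍ) : DifferentiableAt ℝ (inCoord f) (z : ℂ) := by
  by_contra h
  have := hf z
  rw [fderiv_zero_of_not_differentiableAt h, det_zero_clm] at this
  exact lt_irrefl _ this

theorem inCoord_coe (f : ℍ → ℍ) (z : ℍ) : inCoord f (z : ℂ) = f z := by
  simp [inCoord, ofComplex_apply]

theorem inCoord_comp (f g : ℍ → ℍ) : inCoord (f ∘ g) = inCoord f ∘ inCoord g := by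
  funext w
  simp [inCoord, ofComplex_apply]

theorem inCoord_id_eventuallyEq (z : ℍ) : inCoord id =ᶠ[nhds (z : ℂ)] id := by
  filter_upwards [isOpen_upperHalfPlaneSet.mem_nhds z.im_pos] with w hw
  have : inCoord id ((⟨w, hw⟩ : ℍ) : ℂ) = _ := inCoord_coe id ⟨w, hw⟩
  simpa using this

theorem hasFDerivAt_inCoord_id (z : ℍ) :
    HasFDerivAt (inCoord id) (ContinuousLinearMap.id ℝ ℂ) (z : ℂ) :=
  (hasFDerivAt_id (z : ℂ)).congr_of_eventuallyEq (inCoord_id_eventuallyEq z)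

theorem orientationPreserving_id : OrientationPreserving id := by
  intro z
  rw [(hasFDerivAt_inCoord_id z).fderiv]
  simp [ContinuousLinearMap.det]

theorem fderiv_inCoord_comp {f g : ℍ → ℍ} {z : ℍ}
    (hf : DifferentiableAt ℝ (inCoord f) (g z : ℂ)) (hg : DifferentiableAt ℝ (inCoord g) (z : ℂ)) :
    fderiv ℝ (inCoord (f ∘ g)) (z : ℂ) =
      (fderiv ℝ (inCoord f) (g z : ℂ)).comp (fderiv ℝ (inCoord g) (z : ℂ)) := by
  rw [inCoord_comp, fderiv_comp _ (by rwa [inCoord_coe]) hg, inCoord_coe]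

theorem OrientationPreserving.comp {f g : ℍ → ℍ} (hf : OrientationPreserving f)
    (hg : OrientationPreserving g) : OrientationPreserving (f ∘ g) := by
  intro z
  rw [fderiv_inCoord_comp (hf.differentiableAt _) (hg.differentiableAt _)]
  have : ∀ A B : ℂ →L[ℝ] ℂ, (A.comp B).det = A.det * B.det := fun A B => by
    simp [ContinuousLinearMap.det, LinearMap.det_comp]
  rw [this]
  exact mul_pos (hf _) (hg _)

theorem OrientationPreserving.symm {g : ℍ ≃ᵢ ℍ} (hg : OrientationPreserving g) :
    OrientationPreserving g.symm := by
  intro z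
  have hd := hg (g.symm z)
  set L := fderiv ℝ (inCoord g) (g.symm z : ℂ) with hL
  have hfd : HasFDerivAt (inCoord g)
      (L.toContinuousLinearEquivOfDetNeZero hd.ne' : ℂ →L[ℝ] ℂ) (inCoord g.symm z) := by
    rw [inCoord_coe, ContinuousLinearMap.coe_toContinuousLinearEquivOfDetNeZero]
    exact (hg.differentiableAt _).hasFDerivAt
  have hcont : ContinuousAt (inCoord g.symm) (z : ℂ) := by
    have h1 : ContinuousAt (fun w : ℂ => (ofComplex w : ℍ)) (z : ℂ) :=
      (contMDiffAt_ofComplex (n := 0) z.im_pos).continuousAt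
    exact (UpperHalfPlane.continuous_coe.comp g.symm.continuous).continuousAt.comp h1
  have hinv : ∀ᶠ y in nhds (z : ℂ), inCoord g (inCoord g.symm y) = y := by
    filter_upwards [inCoord_id_eventuallyEq z] with y hy
    have : (g ∘ g.symm : ℍ → ℍ) = id := by ext; simp
    rw [← Function.comp_apply (f := inCoord g), ← inCoord_comp, this, hy, id]
  have hder := hfd.of_local_left_inverse hcont hinv
  have hsymm : DifferentiableAt ℝ (inCoord g.symm) (z : ℂ) := hder.differentiableAt
  have hcomp := fderiv_inCoord_comp (f := g) (g := g.symm) (z := z)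
    (hg.differentiableAt _) hsymm
  have hid : (g ∘ g.symm : ℍ → ℍ) = id := by ext; simp
  rw [hid, (hasFDerivAt_inCoord_id z).fderiv, ← hL] at hcomp
  have hdet := congrArg ContinuousLinearMap.det hcomp
  have hmul : ∀ A B : ℂ →L[ℝ] ℂ, (A.comp B).det = A.det * B.det := fun A B => by
    simp [ContinuousLinearMap.det, LinearMap.det_comp]
  rw [hmul] at hdet
  have h1 : (ContinuousLinearMap.id ℝ ℂ).det = 1 := by simp [ContinuousLinearMap.det]
  rw [h1] at hdet
  exact pos_of_mul_pos_right (by rw [← hdet]; exact one_pos) hd.le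

/-- `Isom⁺(ℍ²)`: the group of orientation preserving isometries of the hyperbolic plane, in the
upper half-plane model. -/
def IsomPlus : Subgroup (ℍ ≃ᵢ ℍ) where
  carrier := {g | OrientationPreserving g}
  mul_mem' {f g} hf hg := OrientationPreserving.comp (f := f) (g := g) hf hg
  one_mem' := orientationPreserving_id
  inv_mem' {g} hg := OrientationPreserving.symm (g := g) hg

/-- The topology of pointwise convergence on `Isom⁺(ℍ²)`. -/
instance : TopologicalSpace IsomPlus :=
  TopologicalSpace.induced (fun (g : IsomPlus) (z : ℍ) => (g : ℍ ≃ᵢ ℍ) z) inferInstance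

theorem hasDerivAt_smul (M : SL(2, ℝ)) (z : ℍ) :
    HasDerivAt (inCoord (fun w => M • w)) (1 / denom M z ^ 2) (z : ℂ) := by
  have := (hasStrictDerivAt_smul (g := (M : GL (Fin 2) ℝ)) (by simp) z).hasDerivAt
  simpa using! this

theorem denom_SL (M : SL(2, ℝ)) (z : ℂ) : denom M z = (M 1 0 : ℂ) * z + (M 1 1 : ℂ) := rfl

theorem orientationPreserving_smul (M : SL(2, ℝ)) :
    OrientationPreserving (fun w => M • w) := by
  intro z
  have := (hasStrictFDerivAt_smul (M : GL (Fin 2) ℝ) z).hasFDerivAt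
  have h2 : fderiv ℝ (inCoord (fun w => M • w)) (z : ℂ) = smulFDeriv (M : GL (Fin 2) ℝ) z :=
    this.fderiv
  rw [h2, det_smulFDeriv]
  simp [denom_ne_zero]

/-- The isometry `z ↦ (a z + b) / (c z + d)` given by a real matrix of determinant `1`. -/
def moebius : SL(2, ℝ) →* IsomPlus where
  toFun M := ⟨IsometryEquiv.constSMul M, orientationPreserving_smul M⟩
  map_one' := by ext z; simp
  map_mul' M N := by ext z; simp [mul_smul]

/-- The matrix of the clockwise rotation of angle `α` fixing `i`. -/
def rotMatrix (α : ℝ) : SL(2, ℝ) :=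
  ⟨!![Real.cos (α / 2), -Real.sin (α / 2); Real.sin (α / 2), Real.cos (α / 2)], by
    rw [Matrix.det_fin_two_of]; nlinarith [Real.sin_sq_add_cos_sq (α / 2)]⟩

/-- The matrix of the translation of distance `r` upwards along the imaginary axis. -/
def transMatrix (r : ℝ) : SL(2, ℝ) :=
  ⟨!![Real.exp (r / 2), 0; 0, Real.exp (-(r / 2))], by
    rw [Matrix.det_fin_two_of, ← Real.exp_add]; simp⟩

/-- An orientation preserving isometry that takes the base point `i` with the upward unit vector
to the point `p` with the direction of `v ∈ T_p ℍ² = ℂ`: rotate at `i` from the upward direction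
clockwise by `π / 2 - arg v`, then move `i` to `p` by `z ↦ (im p) z + re p`. -/
def frame (p : ℍ) (v : ℂ) : SL(2, ℝ) := p.toSL2R * rotMatrix (Real.pi / 2 - v.arg)

/-- The clockwise rotation of angle `α` about `p`. -/
def rotation (p : ℍ) (α : ℝ) : IsomPlus :=
  moebius (p.toSL2R * rotMatrix α * p.toSL2R⁻¹)

/-- The translation of distance `r` along the oriented geodesic through `p` in direction `v`. -/
def translation (p : ℍ) (v : ℂ) (r : ℝ) : IsomPlus :=
  moebius (frame p v * transMatrix r * (frame p v)⁻¹)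

/-- The unit speed geodesic with initial condition `(p, v)`, where `v` is a unit vector at `p`. -/
def geodesic (p : ℍ) (v : ℂ) (s : ℝ) : ℍ := frame p v • (⟨⟨0, Real.exp s⟩, Real.exp_pos s⟩ : ℍ)

/-- The group `G_r` generated by the clockwise right-angle rotation `R` about `p` and the
translation `A_r` of distance `r` along the geodesic with initial condition `v ∈ T_p ℍ²`. -/
def robotGroup (p : ℍ) (v : ℂ) (r : ℝ) : Subgroup IsomPlus :=
  Subgroup.closure {rotation p (Real.pi / 2), translation p v r}

/-- `r_t = arcosh (1 + 2 cos (2π / t))`. -/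
def sideLength (t : ℝ) : ℝ := Real.arcosh (1 + 2 * Real.cos (2 * Real.pi / t))

/-! The defining properties of the rotation, the geodesic and the translation. -/

theorem rotMatrix_smul_I (α : ℝ) : rotMatrix α • (I : ℍ) = I := by
  have h := denom_ne_zero (rotMatrix α : GL (Fin 2) ℝ) I
  ext
  rw [coe_specialLinearGroup_apply]
  have h' : (Complex.sin (α / 2) * Complex.I + Complex.cos (α / 2)) ≠ 0 := by
    rw [denom_SL] at h
    simpa [rotMatrix] using h
  simp only [rotMatrix]
  simp
  rw [div_eq_iff h']
  linear_combination (-Complex.sin (α / 2)) * Complex.I_sq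

theorem rotation_apply_self (p : ℍ) (α : ℝ) : (rotation p α : ℍ ≃ᵢ ℍ) p = p := by
  have h : p.toSL2R⁻¹ • p = I := by rw [inv_smul_eq_iff, toSL2R_smul_I]
  change (p.toSL2R * rotMatrix α * p.toSL2R⁻¹) • p = p
  rw [mul_smul, mul_smul, h, rotMatrix_smul_I, toSL2R_smul_I]

theorem hasDerivAt_mul_smul {M N : SL(2, ℝ)} {z : ℍ} {a b : ℂ}
    (hM : HasDerivAt (inCoord (fun w => M • w)) a ((N • z : ℍ) : ℂ))
    (hN : HasDerivAt (inCoord (fun w => N • w)) b (z : ℂ)) :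
    HasDerivAt (inCoord (fun w => (M * N) • w)) (a * b) (z : ℂ) := by
  have h : (fun w : ℍ => (M * N) • w) = (fun w => M • w) ∘ (fun w => N • w) := by
    ext w; simp [mul_smul]
  rw [h, inCoord_comp]
  exact HasDerivAt.comp _ (by rwa [inCoord_coe]) hN

theorem hasDerivAt_rotMatrix (α : ℝ) :
    HasDerivAt (inCoord (fun w => rotMatrix α • w)) (Complex.exp (-(α * Complex.I)))
      ((I : ℍ) : ℂ) := by
  have h := hasDerivAt_smul (rotMatrix α) I
  have hd : denom (rotMatrix α) (I : ℍ) = Complex.exp (α / 2 * Complex.I) := by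
    rw [Complex.exp_mul_I, denom_SL]
    simp [rotMatrix]
    ring
  rw [hd, ← Complex.exp_nat_mul, one_div, ← Complex.exp_neg] at h
  convert h using 2
  push_cast
  ring

theorem hasDerivAt_toSL2R (p z : ℍ) :
    HasDerivAt (inCoord (fun w => p.toSL2R • w)) (p.im : ℂ) (z : ℂ) := by
  have h := hasDerivAt_smul p.toSL2R z
  have hd : 1 / denom p.toSL2R z ^ 2 = (p.im : ℂ) := by
    have h2 : ((√p.im : ℝ) : ℂ) ^ 2 = (p.im : ℂ) := by
      rw [← Complex.ofReal_pow, Real.sq_sqrt p.im_pos.le]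
    rw [denom_SL]
    simp [toSL2R_apply, h2]
  rwa [hd] at h

/-- `rotation p α` acts on the tangent space at `p` as the clockwise rotation of angle `α`. -/
theorem hasDerivAt_rotation (p : ℍ) (α : ℝ) :
    HasDerivAt (inCoord (rotation p α : ℍ ≃ᵢ ℍ)) (Complex.exp (-(α * Complex.I))) (p : ℂ) := by
  have h : p.toSL2R⁻¹ • p = I := by rw [inv_smul_eq_iff, toSL2R_smul_I]
  have hinv := hasDerivAt_smul p.toSL2R⁻¹ p
  set b := 1 / denom (p.toSL2R⁻¹ : SL(2, ℝ)) (p : ℂ) ^ 2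
  have hid := hasDerivAt_mul_smul (hasDerivAt_toSL2R p _) hinv
  have hb : (p.im : ℂ) * b = 1 := by
    refine hid.unique ?_
    have : (fun w : ℍ => (p.toSL2R * p.toSL2R⁻¹) • w) = id := by ext w; simp
    rw [this]
    exact (hasDerivAt_id (p : ℂ)).congr_of_eventuallyEq (inCoord_id_eventuallyEq p)
  have h1 := hasDerivAt_mul_smul (M := p.toSL2R) (N := rotMatrix α) (z := I)
    (hasDerivAt_toSL2R p _) (hasDerivAt_rotMatrix α)
  have h2 := hasDerivAt_mul_smul (M := p.toSL2R * rotMatrix α) (z := p) (by rw [h]; exact h1) hinv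
  convert! h2 using 1
  linear_combination (-Complex.exp (-(α * Complex.I))) * hb

theorem isometry_geodesic (p : ℍ) (v : ℂ) : Isometry (geodesic p v) :=
  (isometry_smul ℍ (frame p v)).comp (isometry_vertical_line 0)

theorem geodesic_zero (p : ℍ) (v : ℂ) : geodesic p v 0 = p := by
  have h : (⟨⟨0, Real.exp 0⟩, Real.exp_pos 0⟩ : ℍ) = I := by
    ext; apply Complex.ext <;> simp
  rw [geodesic, h, frame, mul_smul, rotMatrix_smul_I, toSL2R_smul_I]

theorem hasDerivAt_geodesic (p : ℍ) (v : ℂ) (hv : ‖v‖ = p.im) :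
    HasDerivAt (fun s : ℝ => (geodesic p v s : ℂ)) v 0 := by
  have h1 := hasDerivAt_mul_smul (M := p.toSL2R) (N := rotMatrix (Real.pi / 2 - v.arg)) (z := I)
    (hasDerivAt_toSL2R p _) (hasDerivAt_rotMatrix _)
  have h0 : HasDerivAt (fun s : ℝ => Complex.exp s * Complex.I) (Complex.I) (0 : ℝ) := by
    have := ((Complex.hasDerivAt_exp (0 : ℝ)).comp_ofReal).mul_const Complex.I
    simpa using this
  have hc := HasDerivAt.comp (0 : ℝ) (h₂ := inCoord (fun w => frame p v • w))
    (h := fun s : ℝ => Complex.exp s * Complex.I) (by simpa using! h1) h0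
  convert! hc using 1
  · funext s
    have : Complex.exp s * Complex.I =
        ((⟨⟨0, Real.exp s⟩, Real.exp_pos s⟩ : ℍ) : ℂ) := by
      apply Complex.ext <;> simp [← Complex.ofReal_exp]
    rw [Function.comp_apply, this, inCoord_coe]
    rfl
  · have h2 : Complex.exp (-(((Real.pi / 2 - v.arg : ℝ) : ℂ) * Complex.I)) * Complex.I =
        Complex.exp (v.arg * Complex.I) := by
      have : -(((Real.pi / 2 - v.arg : ℝ) : ℂ) * Complex.I) =
          v.arg * Complex.I - (Real.pi / 2) * Complex.I := by push_cast; ring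
      rw [this, Complex.exp_sub, Complex.exp_pi_div_two_mul_I, div_mul_cancel₀ _ Complex.I_ne_zero]
    push_cast at h2
    rw [mul_assoc, h2, ← hv, Complex.norm_mul_exp_arg_mul_I]

/-- `translation p v r` translates the geodesic with initial condition `(p, v)` by `r`. -/
theorem translation_geodesic (p : ℍ) (v : ℂ) (r s : ℝ) :
    (translation p v r : ℍ ≃ᵢ ℍ) (geodesic p v s) = geodesic p v (s + r) := by
  change (frame p v * transMatrix r * (frame p v)⁻¹) • (geodesic p v s) = _
  rw [geodesic, geodesic, mul_smul, inv_smul_smul, mul_smul]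
  congr 1
  ext
  rw [coe_specialLinearGroup_apply]
  have h : Complex.exp (r / 2) * Complex.exp s / Complex.exp (-(r / 2)) =
      Complex.exp (s + r) := by
    rw [← Complex.exp_add, ← Complex.exp_sub]; congr 1; ring
  have hI (x : ℝ) : (⟨0, Real.exp x⟩ : ℂ) = Complex.exp x * Complex.I := by
    apply Complex.ext <;> simp [← Complex.ofReal_exp]
  simp only [hI, transMatrix]
  simp
  rw [← h]
  ring

end HypPlane

end

noncomputable section

namespace HypPlane

open UpperHalfPlane Filter Topology

/-! The proof runs in `SL(2, ℝ)`, which maps continuously onto `IsomPlus` (`moebius_surjective`), so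
it suffices that the closure `H` of the lifted group is everything. The value of `r_t` is chosen so
that `A * R` has trace `2 cos (π / t)`: it is a rotation by `2πq/p` about some point. Since `R ^ 4 =
-1` lies in `H` and `p`, `q` are coprime, `H` contains the rotation `k` by `2π/p` about that point,
moved to `i` by conjugation. The conjugate `B` of `R` has `normSq B = 2 cot² (π q / p)`, so
Jørgensen's quantity `sin² (π / p) * (normSq B + 2)` equals `2 sin² (π / p) / sin² (π q / p)`, which
is `< 1` exactly because `q > 1` (`two_mul_sin_sq_lt`). Hence the iterates `B`, `B k B⁻¹`, … carry
`i` to points tending to `i` but never equal to it. Multiplying the conjugates of `k` by `k` gives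
elliptic elements whose angles tend to a rational angle without reaching it; their powers fill out
all rotations about `i` (`rotMatrix_mem_of_tendsto`). The rotations and one element moving `i`
generate `SL(2, ℝ)` by the Cartan decomposition (`eq_top_of_rotMatrix_mem`). -/

/-! ### Matrix entries and the one-parameter subgroups. -/

theorem sl2_ext {M N : SL(2, ℝ)} (h00 : M 0 0 = N 0 0) (h01 : M 0 1 = N 0 1)
    (h10 : M 1 0 = N 1 0) (h11 : M 1 1 = N 1 1) : M = N := by
  ext i j
  fin_cases i <;> fin_cases j <;> assumption

theorem sl2_det (M : SL(2, ℝ)) : M 0 0 * M 1 1 - M 0 1 * M 1 0 = 1 := by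
  rw [← Matrix.det_fin_two]
  exact M.det_coe

theorem sl2_mul_apply (M N : SL(2, ℝ)) (i j : Fin 2) :
    (M * N) i j = M i 0 * N 0 j + M i 1 * N 1 j := by
  simp [Matrix.mul_apply, Fin.sum_univ_two]

theorem sl2_inv_apply (M : SL(2, ℝ)) :
    M⁻¹ 0 0 = M 1 1 ∧ M⁻¹ 0 1 = -M 0 1 ∧ M⁻¹ 1 0 = -M 1 0 ∧ M⁻¹ 1 1 = M 0 0 := by
  simp [Matrix.SpecialLinearGroup.SL2_inv_expl]

theorem rotMatrix_apply (α : ℝ) :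
    rotMatrix α 0 0 = Real.cos (α / 2) ∧ rotMatrix α 0 1 = -Real.sin (α / 2) ∧
      rotMatrix α 1 0 = Real.sin (α / 2) ∧ rotMatrix α 1 1 = Real.cos (α / 2) := by
  simp [rotMatrix]

theorem transMatrix_apply (r : ℝ) :
    transMatrix r 0 0 = Real.exp (r / 2) ∧ transMatrix r 0 1 = 0 ∧
      transMatrix r 1 0 = 0 ∧ transMatrix r 1 1 = Real.exp (-(r / 2)) := by
  simp [transMatrix]

theorem continuous_sl2_apply (i j : Fin 2) : Continuous fun M : SL(2, ℝ) => M i j :=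
  (continuous_apply_apply i j).comp continuous_subtype_val

theorem tendsto_sl2 {ι : Type*} {l : Filter ι} {f : ι → SL(2, ℝ)} {N : SL(2, ℝ)}
    (h : ∀ i j, Tendsto (fun n => f n i j) l (𝓝 (N i j))) : Tendsto f l (𝓝 N) := by
  refine tendsto_subtype_rng.2 ?_
  exact tendsto_pi_nhds.2 fun i => tendsto_pi_nhds.2 fun j => h i j

theorem continuous_rotMatrix : Continuous rotMatrix := by
  refine continuous_iff_continuousAt.2 fun α => tendsto_sl2 fun i j => ?_
  fin_cases i <;> fin_cases j <;> simp [rotMatrix] <;>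
    exact Continuous.tendsto (by fun_prop) _

theorem rotMatrix_add (α β : ℝ) : rotMatrix (α + β) = rotMatrix α * rotMatrix β := by
  obtain ⟨a1, a2, a3, a4⟩ := rotMatrix_apply α
  obtain ⟨b1, b2, b3, b4⟩ := rotMatrix_apply β
  obtain ⟨c1, c2, c3, c4⟩ := rotMatrix_apply (α + β)
  apply sl2_ext <;> rw [sl2_mul_apply] <;> simp only [*] <;>
    simp only [add_div, Real.cos_add, Real.sin_add] <;> ring

theorem transMatrix_add (r s : ℝ) : transMatrix (r + s) = transMatrix r * transMatrix s := by
  obtain ⟨a1, a2, a3, a4⟩ := transMatrix_apply r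
  obtain ⟨b1, b2, b3, b4⟩ := transMatrix_apply s
  obtain ⟨c1, c2, c3, c4⟩ := transMatrix_apply (r + s)
  apply sl2_ext <;> rw [sl2_mul_apply] <;> simp only [*] <;>
    simp [add_div, Real.exp_add, mul_comm]

/-- The one-parameter group of rotations about `i`. -/
def rotHom : Multiplicative ℝ →* SL(2, ℝ) :=
  MonoidHom.mk' (fun α => rotMatrix α.toAdd) fun _ _ => rotMatrix_add _ _

/-- The one-parameter group of translations along the imaginary axis. -/
def transHom : Multiplicative ℝ →* SL(2, ℝ) :=
  MonoidHom.mk' (fun r => transMatrix r.toAdd) fun _ _ => transMatrix_add _ _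

theorem rotMatrix_zero : rotMatrix 0 = 1 := map_one rotHom

theorem rotMatrix_neg (α : ℝ) : rotMatrix (-α) = (rotMatrix α)⁻¹ :=
  map_inv rotHom (Multiplicative.ofAdd α)

theorem rotMatrix_zpow (α : ℝ) (m : ℤ) : rotMatrix α ^ m = rotMatrix (m * α) := by
  have := (map_zpow rotHom (Multiplicative.ofAdd α) m).symm
  rw [← ofAdd_zsmul, zsmul_eq_mul] at this
  exact this

theorem transMatrix_neg (r : ℝ) : transMatrix (-r) = (transMatrix r)⁻¹ :=
  map_inv transHom (Multiplicative.ofAdd r)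

theorem transMatrix_pow (r : ℝ) (n : ℕ) : transMatrix r ^ n = transMatrix (n * r) := by
  have := (map_pow transHom (Multiplicative.ofAdd r) n).symm
  rw [← ofAdd_nsmul, nsmul_eq_mul] at this
  exact this

/-- The entries involve `α / 2`, so the period in `SL(2, ℝ)` is `4π`, twice that of the isometry. -/
theorem rotMatrix_add_four_pi_mul (α : ℝ) (m : ℤ) :
    rotMatrix (α + m * (4 * Real.pi)) = rotMatrix α := by
  have h : (α + m * (4 * Real.pi)) / 2 = α / 2 + m * (2 * Real.pi) := by ring
  obtain ⟨a1, a2, a3, a4⟩ := rotMatrix_apply α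
  obtain ⟨c1, c2, c3, c4⟩ := rotMatrix_apply (α + m * (4 * Real.pi))
  apply sl2_ext <;> simp only [*, Real.cos_add_int_mul_two_pi, Real.sin_add_int_mul_two_pi]

/-- `rotMatrix (2π)` is `-1`, hence central. -/
theorem rotMatrix_two_pi_mul_comm (M : SL(2, ℝ)) :
    rotMatrix (2 * Real.pi) * M = M * rotMatrix (2 * Real.pi) := by
  obtain ⟨a1, a2, a3, a4⟩ := rotMatrix_apply (2 * Real.pi)
  rw [mul_div_cancel_left₀ _ two_ne_zero, Real.cos_pi] at a1 a4
  rw [mul_div_cancel_left₀ _ two_ne_zero, Real.sin_pi] at a2 a3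
  apply sl2_ext <;> simp only [sl2_mul_apply] <;> simp only [*] <;> ring

/-- The half turn about `i` reverses the imaginary axis. -/
theorem transMatrix_mul_rotMatrix_pi (r : ℝ) :
    transMatrix r * rotMatrix Real.pi = rotMatrix Real.pi * transMatrix (-r) := by
  obtain ⟨a1, a2, a3, a4⟩ := rotMatrix_apply Real.pi
  obtain ⟨b1, b2, b3, b4⟩ := transMatrix_apply r
  obtain ⟨c1, c2, c3, c4⟩ := transMatrix_apply (-r)
  rw [neg_div] at c1 c4
  rw [neg_neg] at c4
  apply sl2_ext <;> simp only [sl2_mul_apply] <;>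
    simp only [*, Real.cos_pi_div_two, Real.sin_pi_div_two] <;> ring

/-! ### The Cartan decomposition and generation of `SL(2, ℝ)`. -/

/-- The sum of the squares of the entries; it equals `2 cosh (dist I (M • I))`. -/
def normSq (M : SL(2, ℝ)) : ℝ := M 0 0 ^ 2 + M 0 1 ^ 2 + M 1 0 ^ 2 + M 1 1 ^ 2

theorem continuous_normSq : Continuous normSq := by
  unfold normSq
  have := continuous_sl2_apply
  fun_prop

theorem normSq_rotMatrix_mul (α : ℝ) (M : SL(2, ℝ)) : normSq (rotMatrix α * M) = normSq M := by
  obtain ⟨a1, a2, a3, a4⟩ := rotMatrix_apply α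
  simp only [normSq, sl2_mul_apply]
  simp only [*]
  linear_combination (M 0 0 ^ 2 + M 0 1 ^ 2 + M 1 0 ^ 2 + M 1 1 ^ 2) *
    Real.sin_sq_add_cos_sq (α / 2)

theorem normSq_mul_rotMatrix (α : ℝ) (M : SL(2, ℝ)) : normSq (M * rotMatrix α) = normSq M := by
  obtain ⟨a1, a2, a3, a4⟩ := rotMatrix_apply α
  simp only [normSq, sl2_mul_apply]
  simp only [*]
  linear_combination (M 0 0 ^ 2 + M 0 1 ^ 2 + M 1 0 ^ 2 + M 1 1 ^ 2) *
    Real.sin_sq_add_cos_sq (α / 2)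

theorem normSq_transMatrix (r : ℝ) : normSq (transMatrix r) = 2 * Real.cosh r := by
  obtain ⟨a1, a2, a3, a4⟩ := transMatrix_apply r
  simp only [normSq, *]
  rw [Real.cosh_eq, ← Real.exp_nat_mul, ← Real.exp_nat_mul]
  push_cast
  rw [mul_neg, mul_div_cancel₀ _ two_ne_zero]
  ring

/-- The Cartan decomposition of `SL(2, ℝ)`. -/
theorem exists_eq_rotMatrix_mul_transMatrix_mul_rotMatrix (M : SL(2, ℝ)) :
    ∃ α r β, M = rotMatrix α * transMatrix r * rotMatrix β := by
  -- Inner product of the two rows. Left multiplication by `rotMatrix π` swaps the rows with one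
  -- sign change, so `φ` changes sign on `[0, π]` and some `α` makes the rows orthogonal.
  let φ : ℝ → ℝ := fun α => (rotMatrix α * M) 0 0 * (rotMatrix α * M) 1 0 +
    (rotMatrix α * M) 0 1 * (rotMatrix α * M) 1 1
  have hφ : Continuous φ := by
    have h (i j) : Continuous fun α => (rotMatrix α * M) i j :=
      (continuous_sl2_apply i j).comp (continuous_rotMatrix.mul continuous_const)
    exact ((h 0 0).mul (h 1 0)).add ((h 0 1).mul (h 1 1))
  have hπ : φ Real.pi = -φ 0 := by
    obtain ⟨a1, a2, a3, a4⟩ := rotMatrix_apply Real.pi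
    simp only [φ, rotMatrix_zero, one_mul]
    simp only [sl2_mul_apply]
    simp only [*, Real.cos_pi_div_two, Real.sin_pi_div_two]
    ring
  have hmem : (0 : ℝ) ∈ Set.uIcc (φ 0) (φ Real.pi) := by
    rw [hπ, Set.mem_uIcc]
    rcases le_total (φ 0) 0 with h | h
    · left; exact ⟨h, by linarith⟩
    · right; exact ⟨by linarith, h⟩
  obtain ⟨α, -, hα⟩ := intermediate_value_uIcc hφ.continuousOn hmem
  have hdet := sl2_det (rotMatrix α * M)
  simp only [φ] at hα
  set N := rotMatrix α * M with hN
  clear_value N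
  set S := N 0 0 ^ 2 + N 0 1 ^ 2 with hS
  have hS0 : 0 < S := by
    rcases (by positivity : 0 ≤ S).lt_or_eq with h | h
    · exact h
    · have h0 : N 0 0 = 0 := by nlinarith [sq_nonneg (N 0 0), sq_nonneg (N 0 1)]
      have h1 : N 0 1 = 0 := by nlinarith [sq_nonneg (N 0 0), sq_nonneg (N 0 1)]
      rw [h0, h1] at hdet
      norm_num at hdet
  -- The first row is `√S * (cos θ, -sin θ)` with `θ = arg z`. Orthogonality and determinant one
  -- then force the second row.
  set z : ℂ := ⟨N 0 0, -N 0 1⟩ with hz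
  have hzn : ‖z‖ = √S := by
    rw [Complex.norm_def, Complex.normSq_apply, hS]; congr 1; simp only [hz]; ring
  have hx : 0 < √S := Real.sqrt_pos.2 hS0
  have hxx : √S ^ 2 = S := Real.sq_sqrt hS0.le
  have hz0 : z ≠ 0 := by rw [← norm_pos_iff, hzn]; exact hx
  have hcos : √S * Real.cos z.arg = N 0 0 := by
    rw [Complex.cos_arg hz0, hzn]; field_simp; rfl
  have hsin : √S * Real.sin z.arg = -N 0 1 := by
    rw [Complex.sin_arg, hzn]; field_simp; rfl
  refine ⟨-α, Real.log S, 2 * z.arg, ?_⟩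
  rw [mul_assoc, rotMatrix_neg, eq_inv_mul_iff_mul_eq, ← hN]
  have he : Real.exp (Real.log S / 2) = √S := by
    rw [Real.exp_half, Real.exp_log hS0]
  have he' : Real.exp (-(Real.log S / 2)) = (√S)⁻¹ := by
    rw [Real.exp_neg, he]
  obtain ⟨a1, a2, a3, a4⟩ := transMatrix_apply (Real.log S)
  obtain ⟨b1, b2, b3, b4⟩ := rotMatrix_apply (2 * z.arg)
  rw [mul_div_cancel_left₀ _ two_ne_zero] at b1 b2 b3 b4
  rw [he] at a1
  rw [he'] at a4
  apply sl2_ext <;> rw [sl2_mul_apply] <;> simp only [a1, a2, a3, a4, b1, b2, b3, b4]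
  · linarith
  · linarith
  · have : N 1 0 * √S ^ 2 = √S * Real.sin z.arg := by
      rw [hxx, hsin, hS]; linear_combination N 0 0 * hα - N 0 1 * hdet
    rw [zero_mul, zero_add, eq_inv_mul_iff_mul_eq₀ hx.ne']
    exact mul_left_cancel₀ hx.ne' (by linear_combination this)
  · have : N 1 1 * √S ^ 2 = √S * Real.cos z.arg := by
      rw [hxx, hcos, hS]; linear_combination N 0 1 * hα + N 0 0 * hdet
    rw [zero_mul, zero_add, eq_inv_mul_iff_mul_eq₀ hx.ne']
    exact mul_left_cancel₀ hx.ne' (by linear_combination this)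

/-- A subgroup of `SL(2, ℝ)` that contains all rotations about `i` and some other element is
the whole group. -/
theorem eq_top_of_rotMatrix_mem {H : Subgroup SL(2, ℝ)} (hrot : ∀ α, rotMatrix α ∈ H)
    {g : SL(2, ℝ)} (hg : g ∈ H) (hg2 : 2 < normSq g) : H = ⊤ := by
  -- By the Cartan decomposition, modulo rotations an element is determined by its `normSq`, the
  -- sign of `u` being absorbed by inversion.
  have key (M : SL(2, ℝ)) (hM : M ∈ H) (u : ℝ) (hu : normSq M = 2 * Real.cosh u) :
      transMatrix u ∈ H := by
    obtain ⟨α, r, β, rfl⟩ := exists_eq_rotMatrix_mul_transMatrix_mul_rotMatrix M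
    have hr : transMatrix r ∈ H := by
      rwa [H.mul_mem_cancel_right (hrot _), H.mul_mem_cancel_left (hrot _)] at hM
    rw [normSq_mul_rotMatrix, normSq_rotMatrix_mul, normSq_transMatrix] at hu
    rcases abs_eq_abs.1 ((Real.cosh_abs u ▸ Real.cosh_abs r ▸ fun h =>
      Real.cosh_injOn (abs_nonneg r) (abs_nonneg u) h : Real.cosh r = Real.cosh u → |r| = |u|)
      (by linarith)) with h | h
    · rwa [← h]
    · rw [show u = -r by linarith, transMatrix_neg]
      exact H.inv_mem hr
  obtain ⟨α, r, β, rfl⟩ := exists_eq_rotMatrix_mul_transMatrix_mul_rotMatrix g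
  rw [normSq_mul_rotMatrix, normSq_rotMatrix_mul] at hg2
  have hr : transMatrix r ∈ H := by
    rwa [H.mul_mem_cancel_right (hrot _), H.mul_mem_cancel_left (hrot _)] at hg
  have hr0 : r ≠ 0 := by
    rintro rfl
    rw [normSq_transMatrix, Real.cosh_zero] at hg2
    linarith
  have small (u : ℝ) (hu : |u| ≤ |r|) : transMatrix u ∈ H := by
    -- As `α` runs from `0` to `π` this goes continuously from `2` to `2 cosh (2r)`, so every
    -- shorter translation length occurs in `H`.
    let φ : ℝ → ℝ := fun α => normSq (transMatrix r * rotMatrix α * (transMatrix r)⁻¹)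
    have hφ : Continuous φ := continuous_normSq.comp
      ((continuous_const.mul continuous_rotMatrix).mul continuous_const)
    have h0 : φ 0 = 2 := by
      simp only [φ, rotMatrix_zero, mul_one, mul_inv_cancel]
      simp [normSq]
      norm_num
    have hπ : φ Real.pi = 2 * Real.cosh (2 * r) := by
      rw [← normSq_transMatrix, ← normSq_mul_rotMatrix Real.pi (transMatrix (2 * r))]
      simp only [φ]
      congr 1
      rw [two_mul, transMatrix_add, mul_assoc, mul_assoc, transMatrix_mul_rotMatrix_pi,
        transMatrix_neg]
    have hmem : 2 * Real.cosh u ∈ Set.Icc (φ 0) (φ Real.pi) := by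
      rw [h0, hπ]
      refine ⟨by linarith [Real.one_le_cosh u], ?_⟩
      have : Real.cosh u ≤ Real.cosh (2 * r) := by
        rw [Real.cosh_le_cosh, abs_mul, abs_two]
        linarith [abs_nonneg r]
      linarith
    obtain ⟨α, -, hα⟩ := intermediate_value_Icc Real.pi_pos.le hφ.continuousOn hmem
    exact key _ (H.mul_mem (H.mul_mem hr (hrot α)) (H.inv_mem hr)) u hα
  have all (u : ℝ) : transMatrix u ∈ H := by
    obtain ⟨n, hn⟩ := exists_nat_gt (|u| / |r|)
    have hn0 : (0 : ℝ) < n := (by positivity : 0 ≤ |u| / |r|).trans_lt hn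
    have h := H.pow_mem (small (u / n) (by
      rw [abs_div, Nat.abs_cast, div_le_iff₀ hn0]
      rw [div_lt_iff₀ (abs_pos.2 hr0)] at hn
      linarith)) n
    rwa [transMatrix_pow, mul_div_cancel₀ _ hn0.ne'] at h
  rw [Subgroup.eq_top_iff']
  intro M
  obtain ⟨α, r, β, rfl⟩ := exists_eq_rotMatrix_mul_transMatrix_mul_rotMatrix M
  exact H.mul_mem (H.mul_mem (hrot _) (all _)) (hrot _)

/-! ### Elliptic elements and limits of their powers. -/

/-- Half of the rotation angle of an elliptic matrix. -/
def halfAngle (M : SL(2, ℝ)) : ℝ := Real.arccos ((M 0 0 + M 1 1) / 2)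

/-- The fixed point of an elliptic matrix with positive lower left entry. -/
def fixedPoint (M : SL(2, ℝ)) : ℍ :=
  ofComplex ⟨(M 0 0 - M 1 1) / (2 * M 1 0), Real.sin (halfAngle M) / M 1 0⟩

/-- `fixedPoint M` is the root of `c z² + (d - a) z - b = 0` in the upper half-plane. The sign of
`c` tells clockwise from counterclockwise, which the trace cannot see. -/
theorem eq_conj_rotMatrix {M : SL(2, ℝ)} (hc : 0 < M 1 0) (htr : |M 0 0 + M 1 1| < 2) :
    M = (fixedPoint M).toSL2R * rotMatrix (2 * halfAngle M) * (fixedPoint M).toSL2R⁻¹ := by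
  obtain ⟨h1, h2⟩ := abs_lt.1 htr
  have hcos : Real.cos (halfAngle M) = (M 0 0 + M 1 1) / 2 :=
    Real.cos_arccos (by linarith) (by linarith)
  have hsin : 0 < Real.sin (halfAngle M) := by
    refine Real.sin_pos_of_pos_of_lt_pi (Real.arccos_pos.2 (by linarith)) ?_
    exact (Real.arccos_lt_pi).2 (by linarith)
  have hsq := Real.sin_sq_add_cos_sq (halfAngle M)
  have hy : 0 < Real.sin (halfAngle M) / M 1 0 := div_pos hsin hc
  have hdet := sl2_det M
  obtain ⟨b1, b2, b3, b4⟩ := rotMatrix_apply (2 * halfAngle M)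
  rw [mul_div_cancel_left₀ _ two_ne_zero] at b1 b2 b3 b4
  rw [eq_mul_inv_iff_mul_eq]
  have hre : (fixedPoint M).re = (M 0 0 - M 1 1) / (2 * M 1 0) := by
    rw [fixedPoint, ofComplex_apply_of_im_pos hy]; rfl
  have him : (fixedPoint M).im = Real.sin (halfAngle M) / M 1 0 := by
    rw [fixedPoint, ofComplex_apply_of_im_pos hy]; rfl
  set x := (fixedPoint M).re
  set y := (fixedPoint M).im
  set T := (fixedPoint M).toSL2R with hT
  have t00 : T 0 0 = √y := by simp [hT, y]
  have t01 : T 0 1 = x / √y := by simp [hT, x, y]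
  have t10 : T 1 0 = 0 := by simp [hT]
  have t11 : T 1 1 = 1 / √y := by simp [hT, y]
  have hy' : 0 < y := him ▸ hy
  have hy0 : 0 < √y := Real.sqrt_pos.2 hy'
  have hyy : √y ^ 2 = y := Real.sq_sqrt hy'.le
  have hx : x * (2 * M 1 0) = M 0 0 - M 1 1 := by rw [hre]; field_simp
  have hys : y * M 1 0 = Real.sin (halfAngle M) := by rw [him]; field_simp
  clear_value T x y
  rw [hcos] at b1 b4 hsq
  rw [← hys] at b2 b3 hsq
  generalize √y = w at *
  subst hyy
  apply sl2_ext <;> rw [sl2_mul_apply, sl2_mul_apply] <;>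
    simp only [t00, t01, t10, t11, b1, b2, b3, b4]
  · field_simp
    linear_combination (-w) * hx
  · field_simp
    refine mul_left_cancel₀ hc.ne' ?_
    linear_combination 2 * hsq - 2 * hdet + (M 0 0 - M 1 1) / 2 * hx
  · field_simp
    ring
  · field_simp
    linear_combination hx

theorem halfAngle_rotMatrix {τ : ℝ} (h0 : 0 ≤ τ) (h1 : τ ≤ Real.pi) :
    halfAngle (rotMatrix (2 * τ)) = τ := by
  obtain ⟨b1, b2, b3, b4⟩ := rotMatrix_apply (2 * τ)
  rw [mul_div_cancel_left₀ _ two_ne_zero] at b1 b4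
  rw [halfAngle, b1, b4, add_self_div_two, Real.arccos_cos h0 h1]

theorem continuous_halfAngle : Continuous halfAngle :=
  Real.continuous_arccos.comp
    (((continuous_sl2_apply 0 0).add (continuous_sl2_apply 1 1)).div_const 2)

theorem tendsto_fixedPoint {τ : ℝ} (h0 : 0 < τ) (h1 : τ < Real.pi) :
    Tendsto fixedPoint (𝓝 (rotMatrix (2 * τ))) (𝓝 I) := by
  obtain ⟨b1, b2, b3, b4⟩ := rotMatrix_apply (2 * τ)
  rw [mul_div_cancel_left₀ _ two_ne_zero] at b1 b2 b3 b4
  have hs : Real.sin τ ≠ 0 := (Real.sin_pos_of_pos_of_lt_pi h0 h1).ne'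
  have hofc : Tendsto (ofComplex : ℂ → ℍ) (𝓝 (I : ℂ)) (𝓝 I) := by
    have := (contMDiffAt_ofComplex (n := 0) (z := (I : ℂ)) I.im_pos).continuousAt
    rwa [ContinuousAt, ofComplex_apply] at this
  refine hofc.comp ?_
  have hI : ((I : ℍ) : ℂ) = ((0 : ℝ) : ℂ) + ((1 : ℝ) : ℂ) * Complex.I := by simp
  have hform (a b : ℝ) : (⟨a, b⟩ : ℂ) = (a : ℂ) + (b : ℂ) * Complex.I := by
    apply Complex.ext <;> simp
  simp only [hform, hI]
  have e (i j) := (continuous_sl2_apply i j).tendsto (rotMatrix (2 * τ))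
  refine Tendsto.add ?_ (Tendsto.mul_const _ ?_)
  · refine (Complex.continuous_ofReal.tendsto _).comp ?_
    have := ((e 0 0).sub (e 1 1)).div ((e 1 0).const_mul 2) (by rw [b3]; simpa using hs)
    simpa [b1, b4] using! this
  · refine (Complex.continuous_ofReal.tendsto _).comp ?_
    have hc := (Real.continuous_sin.comp continuous_halfAngle).tendsto (rotMatrix (2 * τ))
    have := hc.div (e 1 0) (by rwa [b3])
    simpa [b3, halfAngle_rotMatrix h0.le h1.le, hs] using! this

theorem toSL2R_I : (I : ℍ).toSL2R = 1 := by
  apply sl2_ext <;> simp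

/-- A closed subgroup that contains elements converging to a rotation of finite order about `i`,
with traces different from that of the rotation, contains all rotations about `i`. -/
theorem rotMatrix_mem_of_tendsto {H : Subgroup SL(2, ℝ)} (hH : IsClosed (H : Set SL(2, ℝ)))
    {M : ℕ → SL(2, ℝ)} (hM : ∀ n, M n ∈ H) {τ : ℝ} (h0 : 0 < τ) (h1 : τ < Real.pi)
    {N : ℕ} (hN : N ≠ 0) {j : ℤ} (hNτ : N * τ = j * (2 * Real.pi))
    (hlim : Tendsto M atTop (𝓝 (rotMatrix (2 * τ))))
    (htr : ∀ n, M n 0 0 + M n 1 1 ≠ 2 * Real.cos τ) (φ : ℝ) : rotMatrix φ ∈ H := by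
  obtain ⟨b1, b2, b3, b4⟩ := rotMatrix_apply (2 * τ)
  rw [mul_div_cancel_left₀ _ two_ne_zero] at b1 b2 b3 b4
  have hs : 0 < Real.sin τ := Real.sin_pos_of_pos_of_lt_pi h0 h1
  have hcos : |2 * Real.cos τ| < 2 := by
    have := Real.sin_sq_add_cos_sq τ
    rw [abs_mul, abs_two]
    have : |Real.cos τ| < 1 := by rw [← sq_lt_one_iff_abs_lt_one]; nlinarith
    linarith
  have e (i j) := ((continuous_sl2_apply i j).tendsto _).comp hlim
  have hpos : ∀ᶠ n in atTop, 0 < M n 1 0 := (e 1 0).eventually_const_lt (by rwa [b3])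
  have htrace : ∀ᶠ n in atTop, |M n 0 0 + M n 1 1| < 2 :=
    ((e 0 0).add (e 1 1)).abs.eventually_lt_const (by rwa [b1, b4, ← two_mul])
  have hang : Tendsto (fun n => halfAngle (M n)) atTop (𝓝 τ) := by
    have := (continuous_halfAngle.tendsto _).comp hlim
    rwa [halfAngle_rotMatrix h0.le h1.le] at this
  -- Angle of `M n ^ N` modulo `4π`: it tends to `0` because the limit rotation has finite order,
  -- and is nonzero because the traces differ.
  let ε : ℕ → ℝ := fun n => N * (2 * halfAngle (M n)) - j * (4 * Real.pi)
  have hε : Tendsto ε atTop (𝓝 0) := by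
    have := ((hang.const_mul 2).const_mul (N : ℝ)).sub_const (j * (4 * Real.pi))
    rwa [show N * (2 * τ) - j * (4 * Real.pi) = 0 by linear_combination 2 * hNτ] at this
  have hε0 : ∀ᶠ n in atTop, ε n ≠ 0 := by
    filter_upwards [htrace] with n hn hz
    obtain ⟨l, u⟩ := abs_lt.1 hn
    have hN' : (N : ℝ) ≠ 0 := Nat.cast_ne_zero.2 hN
    have : halfAngle (M n) = τ := mul_left_cancel₀ hN' (by simp only [ε] at hz; linarith)
    apply htr n
    rw [← this, halfAngle, Real.cos_arccos (by linarith) (by linarith)]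
    ring
  -- The multiples of `ε n` are ever finer, so `M n ^ (m n * N)` has angle tending to `φ` about a
  -- point tending to `i`.
  let m : ℕ → ℤ := fun n => round (φ / ε n)
  have hm : Tendsto (fun n => (m n : ℝ) * ε n) atTop (𝓝 φ) := by
    rw [tendsto_iff_dist_tendsto_zero]
    refine squeeze_zero' (.of_forall fun _ => dist_nonneg) ?_ (by simpa using hε.abs)
    filter_upwards [hε0] with n hn
    have h : m n * ε n - φ = -((φ / ε n - m n) * ε n) := by field_simp; ring
    rw [Real.dist_eq, h, abs_neg, abs_mul]
    have := abs_sub_round (φ / ε n)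
    calc |φ / ε n - m n| * |ε n| ≤ (1 / 2) * |ε n| := by gcongr
      _ ≤ |ε n| := by linarith [abs_nonneg (ε n)]
  have hT : Tendsto (fun n => (fixedPoint (M n)).toSL2R) atTop (𝓝 1) := by
    rw [← toSL2R_I]
    exact (continuous_toSL2R.tendsto _).comp ((tendsto_fixedPoint h0 h1).comp hlim)
  have hconj := (hT.mul ((continuous_rotMatrix.tendsto _).comp hm)).mul hT.inv
  rw [one_mul, inv_one, mul_one] at hconj
  refine hH.mem_of_tendsto hconj ?_
  filter_upwards [hpos, htrace] with n hn1 hn2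
  have hmem := H.zpow_mem (hM n) (m n * N)
  rw [eq_conj_rotMatrix hn1 hn2, conj_zpow, rotMatrix_zpow] at hmem
  have hrot : rotMatrix (m n * ε n) = rotMatrix (↑(m n * N) * (2 * halfAngle (M n))) := by
    rw [← rotMatrix_add_four_pi_mul _ (m n * j)]
    congr 1
    simp only [ε]
    push_cast
    ring
  rw [Function.comp_apply, hrot]
  exact hmem

/-! ### Jørgensen's iteration. -/

theorem conj_rotMatrix_apply (B : SL(2, ℝ)) (α : ℝ) :
    (B * rotMatrix α * B⁻¹) 0 0 =
      Real.cos (α / 2) + Real.sin (α / 2) * (B 0 0 * B 1 0 + B 0 1 * B 1 1) ∧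
    (B * rotMatrix α * B⁻¹) 0 1 = -Real.sin (α / 2) * (B 0 0 ^ 2 + B 0 1 ^ 2) ∧
    (B * rotMatrix α * B⁻¹) 1 0 = Real.sin (α / 2) * (B 1 0 ^ 2 + B 1 1 ^ 2) ∧
    (B * rotMatrix α * B⁻¹) 1 1 =
      Real.cos (α / 2) - Real.sin (α / 2) * (B 0 0 * B 1 0 + B 0 1 * B 1 1) := by
  obtain ⟨b1, b2, b3, b4⟩ := rotMatrix_apply α
  obtain ⟨c1, c2, c3, c4⟩ := sl2_inv_apply B
  have hdet := sl2_det B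
  simp only [sl2_mul_apply, b1, b2, b3, b4, c1, c2, c3, c4]
  refine ⟨?_, ?_, ?_, ?_⟩
  · linear_combination Real.cos (α / 2) * hdet
  · ring
  · ring
  · linear_combination Real.cos (α / 2) * hdet

/-- Both sides are the discriminant of the characteristic polynomial of `B Bᵀ`, which has trace
`normSq B` and determinant `1`. It bounds the distance of `B Bᵀ` from the identity by `normSq B`. -/
theorem gram_sub_sq (B : SL(2, ℝ)) :
    (B 0 0 ^ 2 + B 0 1 ^ 2 - (B 1 0 ^ 2 + B 1 1 ^ 2)) ^ 2 +
      4 * (B 0 0 * B 1 0 + B 0 1 * B 1 1) ^ 2 = normSq B ^ 2 - 4 := by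
  have hdet := sl2_det B
  rw [normSq]
  linear_combination (-4) * (B 0 0 * B 1 1 - B 0 1 * B 1 0 + 1) * hdet

/-- The recursion behind Jørgensen's inequality: `x - 2` becomes `(x - 2) * (sin² (α / 2) * (x +
2))`, a contraction while the second factor is below `1`. -/
theorem normSq_conj_rotMatrix (B : SL(2, ℝ)) (α : ℝ) :
    normSq (B * rotMatrix α * B⁻¹) - 2 = Real.sin (α / 2) ^ 2 * (normSq B ^ 2 - 4) := by
  obtain ⟨h1, h2, h3, h4⟩ := conj_rotMatrix_apply B α
  have hg := gram_sub_sq B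
  have hsq := Real.sin_sq_add_cos_sq (α / 2)
  have hn : normSq B = B 0 0 ^ 2 + B 0 1 ^ 2 + (B 1 0 ^ 2 + B 1 1 ^ 2) := by rw [normSq]; ring
  rw [normSq, h1, h2, h3, h4]
  rw [hn] at hg ⊢
  linear_combination 2 * hsq + Real.sin (α / 2) ^ 2 / 2 * hg

/-- This trace equals that of `rotMatrix (2 * α)` only if `normSq B = 2` or `sin (α / 2) = 0`. -/
theorem trace_conj_rotMatrix_mul_rotMatrix (B : SL(2, ℝ)) (α : ℝ) :
    (B * rotMatrix α * B⁻¹ * rotMatrix α) 0 0 + (B * rotMatrix α * B⁻¹ * rotMatrix α) 1 1 =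
      2 * Real.cos (α / 2) ^ 2 - Real.sin (α / 2) ^ 2 * normSq B := by
  obtain ⟨h1, h2, h3, h4⟩ := conj_rotMatrix_apply B α
  obtain ⟨b1, b2, b3, b4⟩ := rotMatrix_apply α
  rw [sl2_mul_apply (B * rotMatrix α * B⁻¹), sl2_mul_apply (B * rotMatrix α * B⁻¹),
    h1, h2, h3, h4, b1, b2, b3, b4, normSq]
  ring

theorem tendsto_zero_of_sq_le {f g : ℕ → ℝ} (h : ∀ n, f n ^ 2 ≤ g n)
    (hg : Tendsto g atTop (𝓝 0)) : Tendsto f atTop (𝓝 0) := by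
  have h2 : Tendsto (fun n => f n ^ 2) atTop (𝓝 0) :=
    squeeze_zero (fun n => sq_nonneg _) h hg
  have h3 := (Real.continuous_sqrt.tendsto _).comp h2
  rw [Real.sqrt_zero] at h3
  refine (tendsto_zero_iff_abs_tendsto_zero _).2 ?_
  simpa [Function.comp_def, Real.sqrt_sq_eq_abs] using h3

/-- If the points `B n • i` converge to `i`, the conjugates of a rotation about `i` by `B n`
converge to that rotation. -/
theorem tendsto_conj_rotMatrix {B : ℕ → SL(2, ℝ)}
    (hB : Tendsto (fun n => normSq (B n)) atTop (𝓝 2)) (α : ℝ) :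
    Tendsto (fun n => B n * rotMatrix α * (B n)⁻¹) atTop (𝓝 (rotMatrix α)) := by
  have hz : Tendsto (fun n => normSq (B n) ^ 2 - 4) atTop (𝓝 0) := by
    have := (hB.pow 2).sub_const 4
    norm_num at this
    exact this
  have hw : Tendsto (fun n => B n 0 0 * B n 1 0 + B n 0 1 * B n 1 1) atTop (𝓝 0) :=
    tendsto_zero_of_sq_le (fun n => by
      rw [← gram_sub_sq]
      linarith [sq_nonneg (B n 0 0 * B n 1 0 + B n 0 1 * B n 1 1),
        sq_nonneg (B n 0 0 ^ 2 + B n 0 1 ^ 2 - (B n 1 0 ^ 2 + B n 1 1 ^ 2))]) hz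
  have hd : Tendsto (fun n => B n 0 0 ^ 2 + B n 0 1 ^ 2 - (B n 1 0 ^ 2 + B n 1 1 ^ 2)) atTop
      (𝓝 0) :=
    tendsto_zero_of_sq_le (fun n => by
      rw [← gram_sub_sq]
      linarith [sq_nonneg (B n 0 0 * B n 1 0 + B n 0 1 * B n 1 1)]) hz
  have hu : Tendsto (fun n => B n 0 0 ^ 2 + B n 0 1 ^ 2) atTop (𝓝 1) := by
    have := (hB.add hd).div_const 2
    norm_num at this
    refine this.congr fun n => ?_
    rw [normSq]; ring
  have hv : Tendsto (fun n => B n 1 0 ^ 2 + B n 1 1 ^ 2) atTop (𝓝 1) := by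
    have := (hB.sub hd).div_const 2
    norm_num at this
    refine this.congr fun n => ?_
    rw [normSq]; ring
  obtain ⟨b1, b2, b3, b4⟩ := rotMatrix_apply α
  refine tendsto_sl2 fun i j => ?_
  fin_cases i <;> fin_cases j
  · have := (hw.const_mul (Real.sin (α / 2))).const_add (Real.cos (α / 2))
    rw [mul_zero, add_zero, ← b1] at this
    exact this.congr fun n => (conj_rotMatrix_apply (B n) α).1.symm
  · have := hu.const_mul (-Real.sin (α / 2))
    rw [mul_one, ← b2] at this
    exact this.congr fun n => (conj_rotMatrix_apply (B n) α).2.1.symm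
  · have := hv.const_mul (Real.sin (α / 2))
    rw [mul_one, ← b3] at this
    exact this.congr fun n => (conj_rotMatrix_apply (B n) α).2.2.1.symm
  · have := (hw.const_mul (Real.sin (α / 2))).const_sub (Real.cos (α / 2))
    rw [mul_zero, sub_zero, ← b4] at this
    exact this.congr fun n => (conj_rotMatrix_apply (B n) α).2.2.2.symm

/-- The iterated conjugates `B, B k B⁻¹, …` of Jørgensen's inequality. -/
def jorgensenSeq (B : SL(2, ℝ)) (α : ℝ) : ℕ → SL(2, ℝ)
  | 0 => B
  | n + 1 => jorgensenSeq B α n * rotMatrix α * (jorgensenSeq B α n)⁻¹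

theorem jorgensenSeq_mem {H : Subgroup SL(2, ℝ)} {B : SL(2, ℝ)} {α : ℝ} (hB : B ∈ H)
    (hα : rotMatrix α ∈ H) (n : ℕ) : jorgensenSeq B α n ∈ H := by
  induction n with
  | zero => exact hB
  | succ n ih => exact H.mul_mem (H.mul_mem ih hα) (H.inv_mem ih)

theorem normSq_jorgensenSeq_bounds {B : SL(2, ℝ)} {α : ℝ} (hα : Real.sin (α / 2) ≠ 0)
    (hB : 2 < normSq B) (h : Real.sin (α / 2) ^ 2 * (normSq B + 2) < 1) (n : ℕ) :
    2 < normSq (jorgensenSeq B α n) ∧ normSq (jorgensenSeq B α n) - 2 ≤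
      (normSq B - 2) * (Real.sin (α / 2) ^ 2 * (normSq B + 2)) ^ n := by
  have hs : 0 < Real.sin (α / 2) ^ 2 := by positivity
  set c := Real.sin (α / 2) ^ 2 * (normSq B + 2) with hc
  have hc0 : 0 < c := by positivity
  induction n with
  | zero => simpa [jorgensenSeq] using hB
  | succ n ih =>
    obtain ⟨ih1, ih2⟩ := ih
    have hrec := normSq_conj_rotMatrix (jorgensenSeq B α n) α
    rw [← jorgensenSeq] at hrec
    set x := normSq (jorgensenSeq B α n)
    have hx : x ≤ normSq B := by
      have : (normSq B - 2) * c ^ n ≤ (normSq B - 2) * 1 := by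
        gcongr
        exact pow_le_one₀ hc0.le h.le
      linarith
    have hpos : 0 < Real.sin (α / 2) ^ 2 * (x ^ 2 - 4) := mul_pos hs (by nlinarith)
    refine ⟨by linarith, ?_⟩
    rw [hrec]
    calc Real.sin (α / 2) ^ 2 * (x ^ 2 - 4)
        = (x - 2) * (Real.sin (α / 2) ^ 2 * (x + 2)) := by ring
      _ ≤ (x - 2) * c := by
        have : 0 ≤ x - 2 := by linarith
        rw [hc]
        gcongr
      _ ≤ (normSq B - 2) * c ^ n * c := by gcongr
      _ = _ := by ring

/-- A closed subgroup of `SL(2, ℝ)` that contains a rotation about `i` of finite order together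
with an element violating Jørgensen's inequality is the whole group. -/
theorem eq_top_of_jorgensen {H : Subgroup SL(2, ℝ)} (hH : IsClosed (H : Set SL(2, ℝ)))
    {p : ℕ} (hp : 3 ≤ p) (hrot : rotMatrix (2 * Real.pi / p) ∈ H) {B : SL(2, ℝ)} (hB : B ∈ H)
    (hB2 : 2 < normSq B) (h : Real.sin (Real.pi / p) ^ 2 * (normSq B + 2) < 1) : H = ⊤ := by
  have hp' : (3 : ℝ) ≤ p := by exact_mod_cast hp
  have hp0 : (0 : ℝ) < p := by linarith
  have hτ0 : 0 < 2 * Real.pi / p := by have := Real.pi_pos; positivity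
  have hτ1 : 2 * Real.pi / p < Real.pi := by
    rw [div_lt_iff₀ hp0]; nlinarith [Real.pi_pos]
  have hhalf : 2 * Real.pi / p / 2 = Real.pi / p := by ring
  set α := 2 * Real.pi / p with hα
  have hs : Real.sin (α / 2) ≠ 0 :=
    (Real.sin_pos_of_pos_of_lt_pi (by linarith) (by linarith)).ne'
  rw [← hhalf] at h
  have bounds := normSq_jorgensenSeq_bounds hs hB2 h
  have hlim : Tendsto (fun n => normSq (jorgensenSeq B α n)) atTop (𝓝 2) := by
    have h0 : Tendsto (fun n => normSq (jorgensenSeq B α n) - 2) atTop (𝓝 0) := by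
      refine squeeze_zero (fun n => by linarith [(bounds n).1]) (fun n => (bounds n).2) ?_
      have := (tendsto_pow_atTop_nhds_zero_of_lt_one (by positivity) h).const_mul (normSq B - 2)
      rwa [mul_zero] at this
    simpa using h0.add_const 2
  refine eq_top_of_rotMatrix_mem (fun φ => ?_) hB hB2
  -- The conjugates of `k = rotMatrix α` all have the trace of `k`; the extra factor `k` makes the
  -- trace depend on `n`. The limit is `k ^ 2 = rotMatrix (2 * α)`, so the half angle is `α`, and `p
  -- * α = 2π`.
  refine rotMatrix_mem_of_tendsto hH
    (M := fun n => jorgensenSeq B α n * rotMatrix α * (jorgensenSeq B α n)⁻¹ * rotMatrix α)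
    (fun n => H.mul_mem (jorgensenSeq_mem hB hrot (n + 1)) hrot) hτ0 hτ1 (N := p) (by omega)
    (j := 1) (by rw [hα]; push_cast; field_simp) ?_ (fun n => ?_) φ
  · rw [two_mul, rotMatrix_add]
    exact (tendsto_conj_rotMatrix hlim α).mul_const _
  · rw [trace_conj_rotMatrix_mul_rotMatrix]
    intro heq
    have h2 : Real.cos α = 2 * Real.cos (α / 2) ^ 2 - 1 := by
      rw [← Real.cos_two_mul]; congr 1; ring
    have h3 := Real.sin_sq_add_cos_sq (α / 2)
    have h4 : Real.sin (α / 2) ^ 2 * (normSq (jorgensenSeq B α n) - 2) = 0 := by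
      linear_combination (-2) * h3 - heq - 2 * h2
    rcases mul_eq_zero.1 h4 with h5 | h5
    · exact hs (pow_eq_zero_iff two_ne_zero |>.1 h5)
    · linarith [(bounds n).1]

/-! ### Orientation preserving isometries are Möbius transformations. -/

/-- The point `i e^r` at signed distance `r` from `i` on the imaginary axis. -/
def verticalPoint (r : ℝ) : ℍ := ⟨⟨0, Real.exp r⟩, Real.exp_pos r⟩

theorem verticalPoint_re (r : ℝ) : (verticalPoint r).re = 0 := rfl

theorem verticalPoint_im (r : ℝ) : (verticalPoint r).im = Real.exp r := rfl

theorem transMatrix_smul_I (r : ℝ) : transMatrix r • (I : ℍ) = verticalPoint r := by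
  ext
  rw [coe_specialLinearGroup_apply]
  have hv : ((verticalPoint r : ℍ) : ℂ) = Complex.exp r * Complex.I := by
    apply Complex.ext <;> simp [verticalPoint, ← Complex.ofReal_exp]
  rw [hv]
  simp only [transMatrix]
  simp
  rw [div_eq_mul_inv, ← Complex.exp_neg, neg_neg, mul_right_comm, ← Complex.exp_add, add_halves]

theorem dist_I_verticalPoint {r : ℝ} (hr : 0 ≤ r) : dist I (verticalPoint r) = r := by
  rw [dist_of_re_eq (by simp [verticalPoint_re]), verticalPoint_im, Real.log_exp, I_im,
    Real.log_one, Real.dist_eq, zero_sub, abs_neg, abs_of_nonneg hr]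

theorem exists_eq_rotMatrix_smul_verticalPoint (z : ℍ) :
    ∃ α, z = rotMatrix α • verticalPoint (dist I z) := by
  suffices ∃ α r, 0 ≤ r ∧ z = rotMatrix α • verticalPoint r by
    obtain ⟨α, r, hr, hz⟩ := this
    refine ⟨α, ?_⟩
    have : dist I z = r := by
      rw [hz]
      nth_rw 1 [← rotMatrix_smul_I α]
      rw [dist_smul, dist_I_verticalPoint hr]
    rwa [this]
  obtain ⟨α, r, β, h⟩ := exists_eq_rotMatrix_mul_transMatrix_mul_rotMatrix z.toSL2R
  have hz : z = rotMatrix α • transMatrix r • (I : ℍ) := by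
    rw [← toSL2R_smul_I z, h, mul_smul, mul_smul, rotMatrix_smul_I]
  rcases le_total 0 r with hr | hr
  · exact ⟨α, r, hr, by rw [hz, transMatrix_smul_I]⟩
  · refine ⟨α + Real.pi, -r, by linarith, ?_⟩
    rw [hz, rotMatrix_add, mul_smul, ← transMatrix_smul_I, ← mul_smul (rotMatrix Real.pi),
      ← transMatrix_mul_rotMatrix_pi, mul_smul (transMatrix r), rotMatrix_smul_I]

/-- Distances to two points of the imaginary axis determine a point up to reflection in that axis:
eliminating `re² + im²` from the two `cosh` formulas leaves a linear equation for the imaginary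
part. -/
theorem im_eq_and_sq_re_eq {z w : ℍ} (hI : dist z I = dist w I)
    (hV : dist z (verticalPoint 1) = dist w (verticalPoint 1)) :
    z.im = w.im ∧ z.re ^ 2 = w.re ^ 2 := by
  have h1 := congrArg Real.cosh hI
  have h2 := congrArg Real.cosh hV
  have he : 1 < Real.exp 1 := Real.one_lt_exp_iff.2 one_pos
  have hz := z.im_pos
  have hw := w.im_pos
  rw [cosh_dist', cosh_dist', I_re, I_im] at h1
  rw [cosh_dist', cosh_dist', verticalPoint_re, verticalPoint_im] at h2
  field_simp at h1 h2
  have h3 : (Real.exp 1 ^ 2 - 1) * (z.im - w.im) = 0 := by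
    linear_combination h1 - h2
  have h4 : z.im = w.im := by
    rcases mul_eq_zero.1 h3 with h | h
    · nlinarith
    · linarith
  refine ⟨h4, ?_⟩
  rw [h4] at h1
  have := mul_left_cancel₀ hw.ne' (by linarith : w.im * (z.re ^ 2) = w.im * (w.re ^ 2))
  exact this

/-- The point `x + i`. -/
def shiftedI (x : ℝ) : ℍ := ⟨⟨x, 1⟩, one_pos⟩

theorem re_eq_of_dist_shiftedI {z w : ℍ} (him : z.im = w.im) (hre : z.re ^ 2 = w.re ^ 2)
    {x y : ℝ} (hxy : x ^ 2 = y ^ 2) (hd : dist z (shiftedI x) = dist w (shiftedI y)) :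
    z.re * x = w.re * y := by
  have h1 := congrArg Real.cosh hd
  have hw := w.im_pos
  rw [cosh_dist', cosh_dist', him] at h1
  change ((z.re - x) ^ 2 + w.im ^ 2 + 1 ^ 2) / (2 * w.im * 1) =
    ((w.re - y) ^ 2 + w.im ^ 2 + 1 ^ 2) / (2 * w.im * 1) at h1
  field_simp at h1
  linarith

theorem eq_one_of_fixes {g : IsomPlus} (hI : (g : ℍ ≃ᵢ ℍ) I = I)
    (hV : (g : ℍ ≃ᵢ ℍ) (verticalPoint 1) = verticalPoint 1) : g = 1 := by
  obtain ⟨g, hg⟩ := g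
  change g I = I at hI
  change g (verticalPoint 1) = verticalPoint 1 at hV
  have hsame (z : ℍ) : (g z).im = z.im ∧ (g z).re ^ 2 = z.re ^ 2 := by
    refine im_eq_and_sq_re_eq ?_ ?_
    · nth_rw 1 [← hI]; exact g.dist_eq z I
    · nth_rw 1 [← hV]; exact g.dist_eq z _
  obtain ⟨hQim, hQre⟩ := hsame (shiftedI 1)
  -- Each point is fixed or reflected; `y = ±1` records the choice at `1 + i`, and the distance to
  -- that point forces the same choice everywhere.
  set y := (g (shiftedI 1)).re with hy
  have hyQ : g (shiftedI 1) = shiftedI y := by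
    refine UpperHalfPlane.ext ?_
    exact Complex.ext rfl hQim
  change y ^ 2 = 1 ^ 2 at hQre
  have hre (z : ℍ) : (g z).re * y = z.re := by
    have := re_eq_of_dist_shiftedI (hsame z).1 (hsame z).2 hQre
      (by rw [← hyQ]; exact g.dist_eq z (shiftedI 1))
    rwa [mul_one] at this
  rcases sq_eq_sq_iff_eq_or_eq_neg.1 hQre with h1 | h1
  · apply Subtype.ext
    apply IsometryEquiv.ext
    intro z
    refine UpperHalfPlane.ext (Complex.ext ?_ (hsame z).1)
    have := hre z
    rwa [h1, mul_one] at this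
  -- Here `g` is `z ↦ -conj z`, whose real differential has determinant `-1`.
  · exfalso
    have hpos := hg I
    have heq : inCoord g =ᶠ[𝓝 ((I : ℍ) : ℂ)] fun w => -(starRingEnd ℂ) w := by
      filter_upwards [isOpen_upperHalfPlaneSet.mem_nhds I.im_pos] with w hw
      have h2 : inCoord g ((⟨w, hw⟩ : ℍ) : ℂ) = _ := inCoord_coe g ⟨w, hw⟩
      change inCoord g w = _ at h2
      rw [h2]
      have h3 := hre ⟨w, hw⟩
      have h4 := (hsame ⟨w, hw⟩).1
      rw [h1] at h3
      apply Complex.ext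
      · rw [Complex.neg_re, Complex.conj_re]
        change (g ⟨w, hw⟩).re = -w.re
        change (g ⟨w, hw⟩).re * -1 = w.re at h3
        linarith
      · rw [Complex.neg_im, Complex.conj_im, neg_neg]
        exact h4
    have hder : HasFDerivAt (inCoord g) (-(Complex.conjCLE : ℂ →L[ℝ] ℂ)) ((I : ℍ) : ℂ) :=
      ((Complex.conjCLE : ℂ →L[ℝ] ℂ).hasFDerivAt.neg).congr_of_eventuallyEq heq
    rw [hder.fderiv] at hpos
    have hdet : (-(Complex.conjCLE : ℂ →L[ℝ] ℂ)).det = -1 := by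
      have h5 : ((-(Complex.conjCLE : ℂ →L[ℝ] ℂ) : ℂ →L[ℝ] ℂ) : ℂ →ₗ[ℝ] ℂ) =
          (-1 : ℝ) • Complex.conjAe.toLinearMap := by
        ext
        simp
      rw [ContinuousLinearMap.det, h5, LinearMap.det_smul, Complex.det_conjAe,
        Complex.finrank_real_complex]
      norm_num
    rw [hdet] at hpos
    linarith

/-- Every orientation preserving isometry of the hyperbolic plane is a Möbius transformation. -/
theorem moebius_surjective : Function.Surjective moebius := by
  intro g
  set z₀ := (g : ℍ ≃ᵢ ℍ) I with hz₀
  set z₁ := z₀.toSL2R⁻¹ • (g : ℍ ≃ᵢ ℍ) (verticalPoint 1) with hz₁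
  have h₀ : z₀.toSL2R⁻¹ • z₀ = I := by rw [inv_smul_eq_iff, toSL2R_smul_I]
  obtain ⟨α, hα⟩ := exists_eq_rotMatrix_smul_verticalPoint z₁
  have hd : dist I z₁ = 1 := by
    rw [← h₀, hz₁, dist_smul, hz₀, (g : ℍ ≃ᵢ ℍ).dist_eq, dist_I_verticalPoint zero_le_one]
  rw [hd] at hα
  have h1 : moebius ((rotMatrix α)⁻¹ * z₀.toSL2R⁻¹) * g = 1 := by
    apply eq_one_of_fixes
    · change ((rotMatrix α)⁻¹ * z₀.toSL2R⁻¹) • z₀ = I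
      rw [mul_smul, h₀, inv_smul_eq_iff, rotMatrix_smul_I]
    · change ((rotMatrix α)⁻¹ * z₀.toSL2R⁻¹) • (g : ℍ ≃ᵢ ℍ) (verticalPoint 1) = _
      rw [mul_smul, ← hz₁, inv_smul_eq_iff, hα]
  exact ⟨((rotMatrix α)⁻¹ * z₀.toSL2R⁻¹)⁻¹, by rw [map_inv]; exact inv_eq_of_mul_eq_one_right h1⟩

theorem continuous_moebius : Continuous moebius := by
  refine continuous_induced_rng.2 (continuous_pi fun z => ?_)
  change Continuous fun M : SL(2, ℝ) => M • z
  fun_prop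

/-! ### Trigonometry of the side length, and density. -/

theorem trace_conj (M N : SL(2, ℝ)) :
    (M⁻¹ * N * M) 0 0 + (M⁻¹ * N * M) 1 1 = N 0 0 + N 1 1 := by
  obtain ⟨c1, c2, c3, c4⟩ := sl2_inv_apply M
  simp only [sl2_mul_apply, c1, c2, c3, c4]
  linear_combination (N 0 0 + N 1 1) * sl2_det M

theorem cosh_half_sideLength {t : ℝ} (ht : 4 < t) :
    Real.cosh (sideLength t / 2) = √2 * Real.cos (Real.pi / t) := by
  have hπ := Real.pi_pos
  have h1 : 2 * Real.pi / t < Real.pi / 2 := by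
    rw [div_lt_iff₀ (by linarith)]; nlinarith
  have h0 : 0 < 2 * Real.pi / t := by positivity
  have hcos : 0 < Real.cos (2 * Real.pi / t) := Real.cos_pos_of_mem_Ioo ⟨by linarith, h1⟩
  have hh : 2 * Real.pi / t = 2 * (Real.pi / t) := by ring
  have hcos' : 0 < Real.cos (Real.pi / t) := Real.cos_pos_of_mem_Ioo ⟨by linarith, by linarith⟩
  have hc : Real.cosh (sideLength t) = 1 + 2 * Real.cos (2 * Real.pi / t) :=
    Real.cosh_arcosh (by linarith)
  have h2 : Real.cosh (sideLength t) = 2 * Real.cosh (sideLength t / 2) ^ 2 - 1 := by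
    have := Real.cosh_two_mul (sideLength t / 2)
    rw [mul_div_cancel₀ _ two_ne_zero, Real.sinh_sq] at this
    linarith
  rw [hh, Real.cos_two_mul] at hc
  have h3 : Real.cosh (sideLength t / 2) ^ 2 = (√2 * Real.cos (Real.pi / t)) ^ 2 := by
    rw [mul_pow, Real.sq_sqrt zero_le_two]; linarith
  exact (pow_left_inj₀ (Real.cosh_pos _).le (by positivity) two_ne_zero).1 h3

/-- A conjugate `B` of the right-angle rotation has prescribed `normSq` when its quotient with a
rotation about `i` has the trace of the translation by the side length. -/
theorem normSq_of_trace {B : SL(2, ℝ)} {τ : ℝ} (hB : B 0 0 + B 1 1 = √2)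
    (hKB : (rotMatrix (2 * τ) * B⁻¹) 0 0 + (rotMatrix (2 * τ) * B⁻¹) 1 1 =
      2 * (√2 * Real.cos τ)) :
    Real.sin τ ^ 2 * normSq B = 2 * Real.cos τ ^ 2 := by
  obtain ⟨b1, b2, b3, b4⟩ := rotMatrix_apply (2 * τ)
  rw [mul_div_cancel_left₀ _ two_ne_zero] at b1 b2 b3 b4
  obtain ⟨c1, c2, c3, c4⟩ := sl2_inv_apply B
  simp only [sl2_mul_apply, b1, b2, b3, b4, c1, c2, c3, c4] at hKB
  have h2 : √2 ^ 2 = 2 := Real.sq_sqrt zero_le_two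
  have h3 : Real.sin τ * (B 1 0 - B 0 1) = √2 * Real.cos τ := by
    linear_combination hKB - Real.cos τ * hB
  have h4 : (B 0 0 + B 1 1) ^ 2 = 2 := by rw [hB, h2]
  have h5 : (Real.sin τ * (B 1 0 - B 0 1)) ^ 2 = 2 * Real.cos τ ^ 2 := by
    rw [h3, mul_pow, h2]
  have h6 := sl2_det B
  rw [normSq]
  linear_combination h5 + Real.sin τ ^ 2 * h4 - 2 * Real.sin τ ^ 2 * h6

theorem rotMatrix_mul_comm (α β : ℝ) : rotMatrix α * rotMatrix β = rotMatrix β * rotMatrix α := by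
  rw [← rotMatrix_add, ← rotMatrix_add, add_comm]

/-- A group containing the rotations by `2πq/p` and by `2π` contains the rotation by `2π/p`. -/
theorem rotMatrix_two_pi_div_mem {H : Subgroup SL(2, ℝ)} {p q : ℕ} (hpq : Nat.Coprime p q)
    (hp : p ≠ 0) (h : rotMatrix (2 * (Real.pi / ((p : ℝ) / q))) ∈ H)
    (h2 : rotMatrix (2 * Real.pi) ∈ H) : rotMatrix (2 * Real.pi / p) ∈ H := by
  -- Bézout: `1 = p a + q b` gives `2π/p = b * (2πq/p) + a * 2π`.
  have hb := Nat.gcd_eq_gcd_ab p q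
  rw [hpq.gcd_eq_one] at hb
  have hb' : (1 : ℝ) = p * (p.gcdA q : ℤ) + q * (p.gcdB q : ℤ) := by exact_mod_cast hb
  have hm := H.mul_mem (H.zpow_mem h (p.gcdB q)) (H.zpow_mem h2 (p.gcdA q))
  rw [rotMatrix_zpow, rotMatrix_zpow, ← rotMatrix_add] at hm
  have hp' : (p : ℝ) ≠ 0 := Nat.cast_ne_zero.2 hp
  convert hm using 2
  rw [div_div_eq_mul_div]
  field_simp
  linear_combination hb'

/-- The trigonometric inequality that makes Jørgensen's inequality fail when `1 < q`. -/
theorem two_mul_sin_sq_lt {p q : ℕ} (hq : 1 < q) (ht : 4 < (p : ℝ) / q) :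
    2 * Real.sin (Real.pi / p) ^ 2 < Real.sin (Real.pi / ((p : ℝ) / q)) ^ 2 := by
  have hπ := Real.pi_pos
  have hq2 : (2 : ℝ) ≤ q := by exact_mod_cast hq
  have hq0 : (0 : ℝ) < q := by linarith
  rw [lt_div_iff₀ hq0] at ht
  have hp0 : (0 : ℝ) < p := by nlinarith
  rw [div_div_eq_mul_div]
  -- This is where `q ≥ 2` enters; then `sin² (2x) = 4 sin² x cos² x > 2 sin² x` for `x = π / p`, as
  -- `cos (2x) > 0`.
  have h1 : 2 * (Real.pi / p) ≤ Real.pi * q / p := by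
    rw [mul_div_assoc', div_le_div_iff_of_pos_right hp0]; nlinarith
  have h2 : Real.pi * q / p < Real.pi / 4 := by
    rw [div_lt_iff₀ hp0]; nlinarith
  have h0 : 0 < Real.pi / p := by positivity
  have hs : 0 < Real.sin (Real.pi / p) := Real.sin_pos_of_pos_of_lt_pi h0 (by linarith)
  have hmono : Real.sin (2 * (Real.pi / p)) ≤ Real.sin (Real.pi * q / p) :=
    Real.sin_le_sin_of_le_of_le_pi_div_two (by linarith) (by linarith) h1
  have hcos : 0 < Real.cos (2 * (Real.pi / p)) :=
    Real.cos_pos_of_mem_Ioo ⟨by linarith, by linarith⟩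
  have hpos : 0 < Real.sin (2 * (Real.pi / p)) :=
    Real.sin_pos_of_pos_of_lt_pi (by linarith) (by linarith)
  rw [Real.cos_two_mul] at hcos
  calc 2 * Real.sin (Real.pi / p) ^ 2
      < Real.sin (2 * (Real.pi / p)) ^ 2 := by
        rw [Real.sin_two_mul]
        nlinarith [mul_pos (pow_pos hs 2) hcos]
    _ ≤ _ := by gcongr

/-- A closed subgroup of `SL(2, ℝ)` containing the right-angle rotation about `i` and the
translation along the imaginary axis by the side length is the whole group. -/
theorem eq_top_of_rotMatrix_transMatrix_mem {H : Subgroup SL(2, ℝ)}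
    (hH : IsClosed (H : Set SL(2, ℝ))) {p q : ℕ} (hpq : Nat.Coprime p q) (hq : 1 < q)
    (ht : 4 < (p : ℝ) / q) (hR : rotMatrix (Real.pi / 2) ∈ H)
    (hA : transMatrix (sideLength ((p : ℝ) / q)) ∈ H) : H = ⊤ := by
  have hπ := Real.pi_pos
  have hcosh := cosh_half_sideLength ht
  have hjorg := two_mul_sin_sq_lt hq ht
  have hp9 : 9 ≤ p := by
    have hq0 : (0 : ℝ) < q := by exact_mod_cast (by omega : 0 < q)
    rw [lt_div_iff₀ hq0] at ht
    have : 4 * q < p := by exact_mod_cast ht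
    omega
  set t : ℝ := (p : ℝ) / q
  set r := sideLength t
  set τ := Real.pi / t with hτ
  have hτ0 : 0 < τ := by positivity
  have hτ1 : τ < Real.pi / 4 := by
    rw [hτ, div_lt_div_iff_of_pos_left hπ (by linarith) (by norm_num)]; exact ht
  have hsin : 0 < Real.sin τ := Real.sin_pos_of_pos_of_lt_pi hτ0 (by linarith)
  have hcos2 : 0 < Real.cos (2 * τ) := Real.cos_pos_of_mem_Ioo ⟨by linarith, by linarith⟩
  have hsq := Real.sin_sq_add_cos_sq τ
  rw [Real.cos_two_mul] at hcos2
  obtain ⟨a1, a2, a3, a4⟩ := transMatrix_apply r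
  obtain ⟨b1, b2, b3, b4⟩ := rotMatrix_apply (Real.pi / 2)
  rw [show Real.pi / 2 / 2 = Real.pi / 4 by ring, Real.cos_pi_div_four] at b1 b4
  rw [show Real.pi / 2 / 2 = Real.pi / 4 by ring, Real.sin_pi_div_four] at b2 b3
  have h22 : √2 ^ 2 = 2 := Real.sq_sqrt zero_le_two
  rw [Real.cosh_eq] at hcosh
  -- The trace of `K` is `√2 cosh (r / 2) = 2 cos (π / t)`: a rotation by `2π/t`. Conjugation by `T`
  -- moves its fixed point to `i`.
  set K := transMatrix r * rotMatrix (Real.pi / 2) with hK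
  have hKtr : K 0 0 + K 1 1 = 2 * Real.cos τ := by
    rw [hK, sl2_mul_apply, sl2_mul_apply, a1, a2, a3, a4, b1, b2, b3, b4]
    linear_combination √2 * hcosh + Real.cos τ * h22
  have hKang : halfAngle K = τ := by
    rw [halfAngle, hKtr, mul_div_cancel_left₀ _ two_ne_zero,
      Real.arccos_cos hτ0.le (by linarith)]
  have hKconj := eq_conj_rotMatrix (M := K)
    (by
      rw [hK, sl2_mul_apply, a3, a4, b1, b3]
      have := Real.exp_pos (-(r / 2))
      positivity)
    (by
      rw [hKtr, abs_mul, abs_two]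
      have : |Real.cos τ| < 1 := by
        rw [← sq_lt_one_iff_abs_lt_one]
        have := pow_pos hsin 2
        linarith
      linarith)
  rw [hKang] at hKconj
  set T := (fixedPoint K).toSL2R
  have hrotT : T⁻¹ * K * T = rotMatrix (2 * τ) := by rw [hKconj]; group
  set B := T⁻¹ * rotMatrix (Real.pi / 2) * T with hB
  have hBtr : B 0 0 + B 1 1 = √2 := by
    rw [hB, trace_conj, b1, b4]; ring
  have hKB : rotMatrix (2 * τ) * B⁻¹ = T⁻¹ * transMatrix r * T := by
    rw [← hrotT, hB, hK]; group
  have hBnorm := normSq_of_trace hBtr (τ := τ) (by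
    rw [hKB, trace_conj, a1, a4]
    linear_combination 2 * hcosh)
  let H' : Subgroup SL(2, ℝ) := H.comap (MulAut.conj T).toMonoidHom
  have hmem (M : SL(2, ℝ)) : M ∈ H' ↔ T * M * T⁻¹ ∈ H := Iff.rfl
  have hH' : IsClosed (H' : Set SL(2, ℝ)) := by
    have hc : Continuous fun M : SL(2, ℝ) => T * M * T⁻¹ := by fun_prop
    exact hH.preimage hc
  have hBmem : B ∈ H' := by
    rw [hmem, hB]
    convert hR using 1
    group
  have hrot : rotMatrix (2 * τ) ∈ H' := by
    rw [hmem, ← hKconj]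
    exact H.mul_mem hA hR
  have h2π : rotMatrix (2 * Real.pi) ∈ H' := by
    rw [hmem, ← rotMatrix_two_pi_mul_comm, mul_inv_cancel_right]
    have := H.zpow_mem hR 4
    rwa [rotMatrix_zpow, show ((4 : ℤ) : ℝ) * (Real.pi / 2) = 2 * Real.pi by push_cast; ring]
      at this
  -- `sin² τ * (normSq B - 2) = 2 cos (2τ)`, positive since `t > 4`: `R` does not fix the centre of
  -- `K`.
  have hB2 : 2 < normSq B := by
    have : 0 < Real.sin τ ^ 2 * (normSq B - 2) := by linarith
    linarith [pos_of_mul_pos_right this (by positivity)]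
  have htop : H' = ⊤ := by
    refine eq_top_of_jorgensen hH' (by omega)
      (rotMatrix_two_pi_div_mem hpq (by omega) hrot h2π) hBmem hB2 ?_
    have h1 : Real.sin τ ^ 2 * (normSq B + 2) = 2 := by linarith
    have h2 := mul_lt_mul_of_pos_right hjorg (by linarith : 0 < normSq B + 2)
    linarith
  rw [Subgroup.eq_top_iff']
  intro M
  have hM : T⁻¹ * M * T ∈ H' := htop ▸ Subgroup.mem_top _
  rw [hmem] at hM
  convert hM using 1
  group

theorem dense_robotGroup (p₀ : ℍ) (v : ℂ) {p q : ℕ} (hpq : Nat.Coprime p q) (hq : 1 < q)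
    (ht : 4 < (p : ℝ) / q) :
    Dense (robotGroup p₀ v (sideLength ((p : ℝ) / q)) : Set IsomPlus) := by
  set r := sideLength ((p : ℝ) / q)
  set F := frame p₀ v with hF
  let Γ : Subgroup SL(2, ℝ) := Subgroup.closure
    {p₀.toSL2R * rotMatrix (Real.pi / 2) * p₀.toSL2R⁻¹, F * transMatrix r * F⁻¹}
  have hmap : robotGroup p₀ v r = Γ.map moebius := by
    rw [MonoidHom.map_closure, Set.image_pair]
    rfl
  -- `frame` differs from `toSL2R` by a rotation about `i`, which commutes with `R`; so one
  -- conjugation normalizes both generators.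
  have hconj : p₀.toSL2R * rotMatrix (Real.pi / 2) * p₀.toSL2R⁻¹ =
      F * rotMatrix (Real.pi / 2) * F⁻¹ := by
    rw [hF, frame, mul_inv_rev, mul_assoc p₀.toSL2R (rotMatrix (_ - _)), rotMatrix_mul_comm]
    group
  let H : Subgroup SL(2, ℝ) := Γ.topologicalClosure.comap (MulAut.conj F).toMonoidHom
  have hmem (M : SL(2, ℝ)) : M ∈ H ↔ F * M * F⁻¹ ∈ Γ.topologicalClosure := Iff.rfl
  have hH : IsClosed (H : Set SL(2, ℝ)) := by
    have hc : Continuous fun M : SL(2, ℝ) => F * M * F⁻¹ := by fun_prop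
    exact Γ.isClosed_topologicalClosure.preimage hc
  have htop : H = ⊤ := by
    refine eq_top_of_rotMatrix_transMatrix_mem hH hpq hq ht ?_ ?_
    · rw [hmem, ← hconj]
      exact Γ.le_topologicalClosure (Subgroup.subset_closure (by simp))
    · rw [hmem]
      exact Γ.le_topologicalClosure (Subgroup.subset_closure (by simp [r]))
  have hΓ : Dense (Γ : Set SL(2, ℝ)) := by
    intro M
    have hM : F⁻¹ * M * F ∈ H := htop ▸ Subgroup.mem_top _
    rw [hmem, show F * (F⁻¹ * M * F) * F⁻¹ = M by group] at hM
    exact hM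
  rw [hmap, Subgroup.coe_map]
  exact moebius_surjective.denseRange.dense_image continuous_moebius hΓ

end HypPlane

end

theorem mainTheorem5 (p₀ : ℍ) (v : ℂ) (hv : ‖v‖ = p₀.im) (p q : ℕ) (hpq : Nat.Coprime p q)
    (hq : 1 < q) (ht : 4 < (p : ℝ) / (q : ℝ)) :
    Dense (HypPlane.robotGroup p₀ v (HypPlane.sideLength ((p : ℝ) / (q : ℝ))) :
      Set HypPlane.IsomPlus) :=
  HypPlane.dense_robotGroup p₀ v hpq hq ht
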